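/- For $X,d,Y\in\mathbb{N}=\{0,1,2,\dots\}$ write $X|_d=Y$ (the best approximate of $X$ up to $d$) if $Y\le d$ and $\sin Y$ is the maximum of $\{\sin n: n\in\mathbb{N},\ n\le d\}\cap(-\infty,\sin X]$; it may be undefined. Call $Y$ a best approximate of $X$ if $X|_d=Y$ for some $d\in\mathbb{N}$; best approximates $a<b$ of $X$ are consecutive if no best approximate of $X$ lies strictly between them. Let ${\bf Best}(d,e,X_1,X_2,Y_1)$ mean that there is $Y_2\in\mathbb{N}$ with $Y_1\le d$, $Y_2\le e$, $Y_1<Y_2$ and $$\big|\sin X_2-\sin X_1-|\sin Y_2-\sin Y_1|\big|<\big|\sin X_2-\sin X_1-|\sin Z_2-\sin Z_1|\big|$$ for all $Z_1,Z_2\in\mathbb{N}$ with $Z_1\le d$, $Z_2\le e$ and $\{Z_1,Z_2\}\ne\{Y_1,Y_2\}$. Let ${\bf Member}(X_1,X_2,X_3,X_4,s,t)$ mean that there are $d_1,d_2,d_3,d_4,e_1,e_2\in\mathbb{N}$ such that: (i) $d_1<d_2<d_3$ are consecutive best approximates of $X_1$; (ii) $d_1\le d_4<d_2$ and $d_4$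 is a best approximate of $X_3$; (iii) $d_1\le e_1<d_2\le e_2<d_3$ and $e_1,e_2$ are best approximates of $X_2$; (iv) $X_4|_{d_1}$ is defined and ${\bf Best}(d_1,e_1,X_4|_{d_1},X_4,s)$; (v) $X_4|_{d_2}$ is defined and ${\bf Best}(d_2,e_2,X_4|_{d_2},X_4,t)$. A sin-PA formula is a quantifier-free first-order formula in the signature $\{<,+,0,1,\sin,(x\mapsto qx)_{q\in\mathbb{Q}}\}$, preceded by blocks of quantifiers; the quantifiers range over $\mathbb{Z}$, and the matrix is evaluated in $\mathbb{R}$. It is an $\exists^p\forall^q$ formula if its prefix is a block of $p$ existential quantifiers followed by a block of $q$ universal ones. **Theorem.** For every finite $S\subseteq\mathbb{N}^2$ there are $X_1,X_2,X_3,X_4\in\mathbb{N}$ such that for all $s,t\in\mathbb{N}$, $$(s,t)\in S\iff{\bf Member}(X_1,X_2,X_3,X_4,s,t).$$ Moreover, the set ${\bf Member}\subseteq\mathbb{N}^6$, viewed as a subset of $\mathbb{Z}^6$, is definable by an $\exists^{10}\forall^{14}$ sin-PA formula. -/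

import Mathlib

/-- The number `Y` is the best approximate `X|_d` of `X` up to `d` (from the left, under sine):
`Y ≤ d` and `sin Y` is the maximum of `sin(ℕ_{≤ d}) ∩ (-∞, sin X]`.  It is a relation, since
`X|_d` may be undefined. -/
def IsBestApproxUpTo (X d Y : ℕ) : Prop :=
  Y ≤ d ∧ IsGreatest (((fun n : ℕ => Real.sin (n : ℝ)) '' {n : ℕ | n ≤ d}) ∩
    Set.Iic (Real.sin (X : ℝ))) (Real.sin (Y : ℝ))

/-- `Y` is a best approximate of `X`, that is, `X|_d = Y` for some `d`. -/
def IsBestApprox (X Y : ℕ) : Prop :=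
  ∃ d : ℕ, IsBestApproxUpTo X d Y

/-- `a < b` are consecutive best approximates of `X`. -/
def ConsecutiveBestApprox (X a b : ℕ) : Prop :=
  a < b ∧ IsBestApprox X a ∧ IsBestApprox X b ∧ ∀ c : ℕ, IsBestApprox X c → ¬ (a < c ∧ c < b)

/-- `g(X̄, Ȳ) = |sin X₂ - sin X₁ - |sin Y₂ - sin Y₁||`. -/
noncomputable def sinDiffDist (X₁ X₂ Y₁ Y₂ : ℕ) : ℝ :=
  abs (Real.sin (X₂ : ℝ) - Real.sin (X₁ : ℝ) - abs (Real.sin (Y₂ : ℝ) - Real.sin (Y₁ : ℝ)))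

/-- The relation **Best**: `Y₁` is the lesser entry of the best approximate, among the pairs in
`ℕ_{≤ d} × ℕ_{≤ e}`, of the pair `(X₁, X₂)` under the difference of sines. -/
def Best (d e X₁ X₂ Y₁ : ℕ) : Prop :=
  ∃ Y₂ : ℕ, Y₁ ≤ d ∧ Y₂ ≤ e ∧ Y₁ < Y₂ ∧
    ∀ Z₁ Z₂ : ℕ, Z₁ ≤ d → Z₂ ≤ e → ({Z₁, Z₂} : Set ℕ) ≠ {Y₁, Y₂} →
      sinDiffDist X₁ X₂ Y₁ Y₂ < sinDiffDist X₁ X₂ Z₁ Z₂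

/-- The relation **Admissible**. The last two clauses say that **Best** holds at `X₄|_{d₁}` and at
`X₄|_{d₂}`, and that these are defined. -/
def Admissible (d₁ d₂ d₃ d₄ e₁ e₂ X₁ X₂ X₃ X₄ s t : ℕ) : Prop :=
  (ConsecutiveBestApprox X₁ d₁ d₂ ∧ ConsecutiveBestApprox X₁ d₂ d₃) ∧
  (d₁ ≤ d₄ ∧ d₄ < d₂ ∧ IsBestApprox X₃ d₄) ∧
  (d₁ ≤ e₁ ∧ e₁ < d₂ ∧ d₂ ≤ e₂ ∧ e₂ < d₃ ∧ IsBestApprox X₂ e₁ ∧ IsBestApprox X₂ e₂) ∧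
  (∃ Y : ℕ, IsBestApproxUpTo X₄ d₁ Y ∧ Best d₁ e₁ Y X₄ s) ∧
  (∃ Y : ℕ, IsBestApproxUpTo X₄ d₂ Y ∧ Best d₂ e₂ Y X₄ t)

/-- The relation **Member**. -/
def Member (X₁ X₂ X₃ X₄ s t : ℕ) : Prop :=
  ∃ d₁ d₂ d₃ d₄ e₁ e₂ : ℕ, Admissible d₁ d₂ d₃ d₄ e₁ e₂ X₁ X₂ X₃ X₄ s t

/-- Function symbols `0`, `1`, `sin`, `λ_q` (`q ∈ ℚ`) and `+`. -/
inductive SinFunc : ℕ → Type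
  | zero : SinFunc 0
  | one : SinFunc 0
  | sin : SinFunc 1
  | scale (q : ℚ) : SinFunc 1
  | add : SinFunc 2

/-- The relation symbol `<`. -/
inductive SinRel : ℕ → Type
  | lt : SinRel 2

/-- The signature `{<, +, 0, 1, sin, (λ_q)_{q ∈ ℚ}}`. -/
def sinLanguage : FirstOrder.Language :=
  ⟨SinFunc, SinRel⟩

/-- The real numbers as a structure in this signature, with `λ_q : x ↦ q x`. -/
noncomputable instance sinStructure : sinLanguage.Structure ℝ where
  funMap := fun {_} f =>
    match f with
    | SinFunc.zero => fun _ => 0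
    | SinFunc.one => fun _ => 1
    | SinFunc.sin => fun v => Real.sin (v 0)
    | SinFunc.scale q => fun v => (q : ℝ) * v 0
    | SinFunc.add => fun v => v 0 + v 1
  RelMap := fun {_} r =>
    match r with
    | SinRel.lt => fun v => v 0 < v 1

/-- A sin-PA formula with `n` free variables: a quantifier-free formula preceded by blocks of
quantifiers.  A block of `k` quantifiers binds the last `k` of `n + k` variables. -/
inductive SinPAFormula : ℕ → Type
  | matrix {n : ℕ} (φ : sinLanguage.Formula (Fin n)) (hφ : φ.IsQF) : SinPAFormula n
  | ex {n : ℕ} (k : ℕ) (Φ : SinPAFormula (n + k)) : SinPAFormula n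
  | all {n : ℕ} (k : ℕ) (Φ : SinPAFormula (n + k)) : SinPAFormula n

/-- Truth of a sin-PA formula at an integer point: the matrix is evaluated in the real numbers,
and all quantifiers range over the integers. -/
def SinPAFormula.Holds : {n : ℕ} → SinPAFormula n → (Fin n → ℤ) → Prop
  | _, .matrix φ _, X => φ.Realize (fun i => ((X i : ℤ) : ℝ))
  | _, .ex k Φ, X => ∃ Y : Fin k → ℤ, Φ.Holds (Fin.append X Y)
  | _, .all k Φ, X => ∀ Y : Fin k → ℤ, Φ.Holds (Fin.append X Y)

/-- `Φ` is an `∃^p ∀^q` formula. -/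
def SinPAFormula.IsExistsForall {n : ℕ} (p q : ℕ) (Φ : SinPAFormula n) : Prop :=
  ∃ (φ : sinLanguage.Formula (Fin (n + p + q))) (hφ : φ.IsQF),
    Φ = .ex p (.all q (.matrix φ hφ))

/-- The set `A ⊆ ℤ^n` is definable by an `∃^p ∀^q` sin-PA formula. -/
def ExistsForallDefinable {n : ℕ} (p q : ℕ) (A : Set (Fin n → ℤ)) : Prop :=
  ∃ Φ : SinPAFormula n, Φ.IsExistsForall p q ∧ A = {X | Φ.Holds X}

/-! The numbers `exp (i k)`, `k ∈ ℤ`, are linearly independent over ℤ, by Hermite's argument. Hence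
a nonzero distance `|sin e - sin s|` determines the pair `{s, e}` (`abs_natSin_sub_eq`), while sines
of natural numbers are dense in `[-1, 1]` (`exists_natSin_mem_Ioo`).

The finite set is encoded one pair at a time. The invariant is an open interval such that every `X₄`
with sine in it encodes the pairs so far. To store `s` at scale `d`, take the best approximate `a`
below the top of the interval, some `Y > s` with `sin Y - sin s` small and positive, and shrink the
interval to a neighbourhood of `sin a + sin Y - sin s`; uniqueness of differences makes `(s, Y)` the
strict optimum (`exists_interval_best`). `X₁` and `X₂` store the scales: each can be replaced by a
larger number with just one more best approximate (`exists_isBestApprox_extend`). Interleaving the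
new scales ensures that only the intended triple of consecutive scales is read (`member_extend`).

For definability, every clause becomes universal once the ten witnesses are given, and since ∀
commutes with ∧ the clauses share their universal variables. -/

/-! ### Linear independence of the exponentials `exp (i k)` -/

open Polynomial in
theorem intCast_mul_I_mem_aroots (T : Finset ℤ) (hT : ∀ k ∈ T, k ≠ 0) {k : ℤ} (hk : k ∈ T) :
    (k : ℂ) * Complex.I ∈ (∏ j ∈ T, (X ^ 2 + C (j ^ 2)) : ℤ[X]).aroots ℂ := by
  rw [mem_aroots]
  refine ⟨Finset.prod_ne_zero_iff.2 fun j hj h0 => ?_, ?_⟩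
  · have := congrArg (eval 0) h0
    simp [hT j hj] at this
  · rw [map_prod]
    refine Finset.prod_eq_zero hk ?_
    simp [mul_pow]

open Polynomial in
theorem aeval_intCast_mul_I (k : ℤ) (g : ℤ[X]) :
    aeval ((k : ℂ) * Complex.I) g = GaussianInt.toComplex (aeval (⟨0, k⟩ : GaussianInt) g) := by
  have h : GaussianInt.toComplex ⟨0, k⟩ = (k : ℂ) * Complex.I := by
    rw [GaussianInt.toComplex_def']; simp
  rw [← h]
  simp only [aeval_def, hom_eval₂]
  congr 1
  exact RingHom.ext_int _ _

open Polynomial in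
/-- The coefficient at `0` of a vanishing integer combination of the numbers `exp (i k)` is zero. -/
theorem coeff_zero_eq_zero_of_sum_exp_eq_zero (T : Finset ℤ) (hT : ∀ k ∈ T, k ≠ 0) (a : ℤ → ℤ)
    (h : (a 0 : ℂ) + ∑ k ∈ T, (a k : ℂ) * Complex.exp (k * Complex.I) = 0) : a 0 = 0 := by
  by_contra ha
  set f : ℤ[X] := ∏ j ∈ T, (X ^ 2 + C (j ^ 2)) with hf
  have hf0 : f.eval 0 ≠ 0 := by
    rw [hf, eval_prod]
    refine Finset.prod_ne_zero_iff.2 fun j hj => ?_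
    simpa using hT j hj
  obtain ⟨c, hc⟩ := LindemannWeierstrass.exp_polynomial_approx f hf0
  set B : ℝ := ∑ k ∈ T, |(a k : ℝ)| with hB
  have hlim := (FloorSemiring.tendsto_pow_div_factorial_atTop c).const_mul (B * c)
  rw [mul_zero] at hlim
  obtain ⟨n₀, hn₀⟩ := Filter.eventually_atTop.1 (hlim.eventually_lt_const one_pos)
  obtain ⟨p, hpge, hp⟩ :=
    Nat.exists_infinite_primes (n₀ + (f.eval 0).natAbs + (a 0).natAbs + 2)
  have hpp := Nat.prime_iff_prime_int.1 hp
  obtain ⟨n, hn, g, -, hg⟩ := hc p (by omega) hp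
  have hsmall := hn₀ (p - 1) (by omega)
  -- Since the points `k i` are Gaussian integers, so is `W`. The assumed relation cancels the main
  -- terms and leaves only approximation errors, so `‖W‖ < 1` for large `p`; thus `W.re = 0`, and
  -- `p` divides `n * a 0`.
  set W : GaussianInt := n * a 0 + p * ∑ k ∈ T, (a k : GaussianInt) * aeval (⟨0, k⟩ : GaussianInt) g
    with hW
  have hnorm : ‖GaussianInt.toComplex W‖ < 1 := by
    have e : GaussianInt.toComplex W = - ∑ k ∈ T, (a k : ℂ) *
        (n • Complex.exp (k * Complex.I) - p • aeval ((k : ℂ) * Complex.I) g) := by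
      have e0 : (n : ℂ) * (a 0 : ℂ) = - ∑ k ∈ T, (a k : ℂ) * (n * Complex.exp (k * Complex.I)) := by
        rw [eq_neg_of_add_eq_zero_left h, mul_neg, Finset.mul_sum]
        congr 1
        exact Finset.sum_congr rfl fun k _ => by ring
      simp only [hW, map_add, map_mul, map_sum, map_intCast, map_natCast, ← aeval_intCast_mul_I,
        e0, zsmul_eq_mul, nsmul_eq_mul, mul_sub, Finset.sum_sub_distrib, neg_sub, Finset.mul_sum]
      rw [neg_add_eq_sub]
      congr 1
      exact Finset.sum_congr rfl fun k _ => by ring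
    rw [e, norm_neg]
    calc _ ≤ ∑ k ∈ T, |(a k : ℝ)| * (c ^ p / (p - 1).factorial) := by
          refine (norm_sum_le _ _).trans (Finset.sum_le_sum fun k hk => ?_)
          rw [norm_mul, Complex.norm_intCast]
          exact mul_le_mul_of_nonneg_left (hg (intCast_mul_I_mem_aroots T hT hk)) (abs_nonneg _)
      _ = B * c * (c ^ (p - 1) / (p - 1).factorial) := by
          rw [← Finset.sum_mul, ← hB]
          obtain ⟨q, rfl⟩ : ∃ q, p = q + 1 := ⟨p - 1, by omega⟩
          simp only [Nat.add_sub_cancel, pow_succ]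
          ring
      _ < 1 := hsmall
  have hre : W.re = 0 := by
    have := (Complex.abs_re_le_norm _).trans_lt hnorm
    rw [← GaussianInt.intCast_re] at this
    exact Int.abs_lt_one_iff.1 (by exact_mod_cast this)
  have hdvd : (p : ℤ) ∣ n * a 0 := by
    have : n * a 0 + p * (∑ k ∈ T, (a k : GaussianInt) * aeval (⟨0, k⟩ : GaussianInt) g).re = 0 := by
      refine Eq.trans ?_ hre
      rw [hW]
      simp
    exact ⟨-(∑ k ∈ T, (a k : GaussianInt) * aeval (⟨0, k⟩ : GaussianInt) g).re, by linarith⟩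
  rcases hpp.dvd_or_dvd hdvd with h1 | h1
  · exact hn h1
  · have := Nat.le_of_dvd (Int.natAbs_pos.2 ha) (Int.natCast_dvd.1 h1)
    omega

/-- Multiplying a relation by `exp (-i m)` moves its coefficient at `m` to `0`. -/
theorem linearIndependent_exp_int_mul_I :
    LinearIndependent ℤ (fun k : ℤ => Complex.exp (k * Complex.I)) := by
  rw [linearIndependent_iff']
  intro T a h m hm
  have := coeff_zero_eq_zero_of_sum_exp_eq_zero ((T.erase m).map (Equiv.subRight m).toEmbedding)
    (by
      simp only [Finset.mem_map, Finset.mem_erase]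
      rintro k ⟨j, ⟨hj, -⟩, rfl⟩
      simpa [sub_eq_zero] using hj) (fun k => a (k + m)) ?_
  · simpa using this
  · have h2 := congrArg (fun z => z * Complex.exp (-(m * Complex.I))) h
    simp only [zero_mul, Finset.sum_mul] at h2
    rw [← Finset.add_sum_erase _ _ hm] at h2
    rw [← h2, Finset.sum_map]
    simp only [zsmul_eq_mul, mul_assoc, ← Complex.exp_add]
    congr 1
    · simp
    · refine Finset.sum_congr rfl fun k _ => ?_
      simp [add_mul, sub_eq_add_neg]

/-! ### Sines of natural numbers: differences and density -/

/-- The formal difference `[n] - [-n]`, of which `2 i sin n` is the value. -/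
noncomputable def expDiff (n : ℕ) : ℤ →₀ ℤ :=
  Finsupp.single (n : ℤ) 1 - Finsupp.single (-n : ℤ) 1

theorem linearCombination_expDiff (n : ℕ) :
    Finsupp.linearCombination ℤ (fun k : ℤ => Complex.exp (k * Complex.I)) (expDiff n) =
      2 * Complex.I * (Real.sin n : ℂ) := by
  simp only [expDiff, map_sub, Finsupp.linearCombination_single, one_smul, Complex.ofReal_sin,
    Complex.sin]
  push_cast
  rw [neg_mul]
  linear_combination (Complex.exp (-(n * Complex.I)) - Complex.exp (n * Complex.I)) * -Complex.I_sq

theorem expDiff_apply (n k : ℕ) (hk : 0 < k) : expDiff n (k : ℤ) = if n = k then 1 else 0 := by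
  have : ¬ (-(n : ℤ) = k) := by omega
  simp [expDiff, Finsupp.single_apply, this]

/-- By linear independence the two formal sums agree; their coefficients at positive indices then
identify the entries. -/
theorem natSin_sub_eq {s e z₁ z₂ : ℕ} (hse : s < e)
    (h : Real.sin e - Real.sin s = Real.sin z₂ - Real.sin z₁) : z₁ = s ∧ z₂ = e := by
  have h1 : expDiff e - expDiff s = expDiff z₂ - expDiff z₁ := by
    refine linearIndependent_exp_int_mul_I ?_
    simp only [map_sub, linearCombination_expDiff, ← mul_sub, ← Complex.ofReal_sub, h]
  have h2 (k : ℕ) (hk : 0 < k) : ((if e = k then 1 else 0) - (if s = k then 1 else 0) : ℤ) =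
      (if z₂ = k then 1 else 0) - (if z₁ = k then 1 else 0) := by
    have := DFunLike.congr_fun h1 (k : ℤ)
    simpa [expDiff_apply _ k hk] using this
  have he := h2 e (by omega)
  have hz : z₂ = e := by
    by_contra hne
    simp only [hne, hse.ne, if_true, if_false] at he
    split_ifs at he <;> omega
  subst hz
  refine ⟨?_, rfl⟩
  -- The index `0` carries no information, but if `s` and `z₁` differ, one of them is positive.
  have hs := h2 s
  have hz := h2 z₁
  by_contra hne
  have hne' : s ≠ z₁ := fun h => hne h.symm
  simp [hne, hne'] at hs hz
  omega

theorem natSin_injective : Function.Injective (fun n : ℕ => Real.sin n) := by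
  intro a b hab
  by_contra hne
  have hab : Real.sin a = Real.sin b := hab
  rcases lt_or_gt_of_ne hne with h | h
  · have := natSin_sub_eq (z₁ := 0) (z₂ := 0) h (by simp [hab])
    omega
  · have := natSin_sub_eq (z₁ := 0) (z₂ := 0) h (by simp [hab])
    omega

theorem abs_natSin_sub_eq {s e z₁ z₂ : ℕ} (hse : s < e)
    (h : |Real.sin e - Real.sin s| = |Real.sin z₂ - Real.sin z₁|) :
    ({z₁, z₂} : Set ℕ) = {s, e} := by
  rcases abs_eq_abs.1 h with h | h
  · obtain ⟨rfl, rfl⟩ := natSin_sub_eq hse h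
    rfl
  · obtain ⟨rfl, rfl⟩ := natSin_sub_eq (z₁ := z₂) (z₂ := z₁) hse (by rw [h, neg_sub])
    exact Set.pair_comm _ _

theorem exists_natSin_mem_Ioo {u v : ℝ} (huv : u < v) (hu : -1 ≤ u) (hv : v ≤ 1) (M : ℕ) :
    ∃ n > M, u < Real.sin n ∧ Real.sin n < v := by
  have hirr : Irrational ((1 : ℝ) / (2 * Real.pi)) := by
    have := irrational_pi.natCast_mul (m := 2) (by norm_num)
    simpa using this.inv
  have : Fact (0 < 2 * Real.pi) := ⟨by positivity⟩
  have : CompactSpace Real.Angle := inferInstanceAs (CompactSpace (AddCircle (2 * Real.pi)))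
  have hdense : DenseRange (fun n : ℤ => n • ((1 : ℝ) : Real.Angle)) :=
    AddCircle.denseRange_zsmul_coe_iff.2 hirr
  set θ : Real.Angle := ((Real.arcsin ((u + v) / 2) : ℝ) : Real.Angle) with hθ
  have hθs : θ.sin = (u + v) / 2 := by
    rw [hθ, Real.Angle.sin_coe, Real.sin_arcsin] <;> linarith
  -- Clustering along natural multiples, rather than mere density of integer ones, yields `n > M`.
  have hcl : MapClusterPt θ Filter.atTop (fun n : ℕ => n • ((1 : ℝ) : Real.Angle)) :=
    ((mapClusterPt_atTop_nsmul_tfae θ ((1 : ℝ) : Real.Angle)).out 0 3).2 (hdense θ)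
  have hnhds : ∀ᶠ φ : Real.Angle in nhds θ, u < φ.sin ∧ φ.sin < v := by
    have hc : Filter.Tendsto Real.Angle.sin (nhds θ) (nhds ((u + v) / 2)) :=
      hθs ▸ Real.Angle.continuous_sin.tendsto θ
    exact hc.eventually (Ioo_mem_nhds (by linarith) (by linarith))
  obtain ⟨n, hn, hnM⟩ :=
    ((hcl.frequently hnhds).and_eventually (Filter.eventually_gt_atTop M)).exists
  rw [← Real.Angle.coe_nsmul, Real.Angle.sin_coe] at hn
  exact ⟨n, hnM, by simpa using hn⟩

/-! ### Best approximates and their extension -/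

theorem isBestApproxUpTo_iff {X d Y : ℕ} : IsBestApproxUpTo X d Y ↔
    Y ≤ d ∧ Real.sin Y ≤ Real.sin X ∧
      ∀ n : ℕ, n ≤ d → Real.sin n ≤ Real.sin X → Real.sin n ≤ Real.sin Y := by
  constructor
  · rintro ⟨h1, ⟨-, h2⟩, h3⟩
    exact ⟨h1, h2, fun n hn hs => h3 ⟨⟨n, hn, rfl⟩, hs⟩⟩
  · rintro ⟨h1, h2, h3⟩
    refine ⟨h1, ⟨⟨Y, h1, rfl⟩, h2⟩, ?_⟩
    rintro _ ⟨⟨n, hn, rfl⟩, hs⟩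
    exact h3 n hn hs

theorem isBestApprox_iff {X Y : ℕ} : IsBestApprox X Y ↔
    Real.sin Y ≤ Real.sin X ∧
      ∀ n : ℕ, n ≤ Y → Real.sin n ≤ Real.sin X → Real.sin n ≤ Real.sin Y := by
  simp only [IsBestApprox, isBestApproxUpTo_iff]
  exact ⟨fun ⟨d, h1, h2, h3⟩ => ⟨h2, fun n hn => h3 n (hn.trans h1)⟩,
    fun ⟨h1, h2⟩ => ⟨Y, le_rfl, h1, h2⟩⟩

theorem IsBestApproxUpTo.unique {X d Y Y' : ℕ} (h : IsBestApproxUpTo X d Y)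
    (h' : IsBestApproxUpTo X d Y') : Y = Y' :=
  natSin_injective (h.2.unique h'.2)

theorem isBestApprox_self (X : ℕ) : IsBestApprox X X :=
  isBestApprox_iff.2 ⟨le_rfl, fun _ _ h => h⟩

theorem IsBestApprox.le {X Y : ℕ} (h : IsBestApprox X Y) : Y ≤ X := by
  rw [isBestApprox_iff] at h
  by_contra! hlt
  exact hlt.ne (natSin_injective (le_antisymm (h.2 X hlt.le le_rfl) h.1))

theorem Best.unique {d e X₁ X₂ s s' : ℕ} (h : Best d e X₁ X₂ s) (h' : Best d e X₁ X₂ s') :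
    s = s' := by
  obtain ⟨Y, hs, hY, hsY, hmin⟩ := h
  obtain ⟨Y', hs', hY', hsY', hmin'⟩ := h'
  by_contra hne
  have hpair : ({s', Y'} : Set ℕ) ≠ {s, Y} := by
    rw [Ne, Set.pair_eq_pair_iff]
    omega
  exact lt_asymm (hmin s' Y' hs' hY' hpair) (hmin' s Y hs hY hpair.symm)

/-- If the sine were 1 at `m + 1`, it would be symmetric about that point, so `sin m = sin (m + 2)`,
against injectivity. -/
theorem natSin_lt_one (n : ℕ) : Real.sin n < 1 := by
  refine lt_of_le_of_ne (Real.sin_le_one _) fun h => ?_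
  obtain _ | m := n
  · simp at h
  · have hcos : Real.cos ((m + 1 : ℕ) : ℝ) = 0 := by
      have := Real.sin_sq_add_cos_sq ((m + 1 : ℕ) : ℝ)
      rw [h] at this
      simpa using this
    have : m = m + 2 := natSin_injective <| by
      have e1 : (m : ℝ) = ((m + 1 : ℕ) : ℝ) - 1 := by push_cast; ring
      have e2 : ((m + 2 : ℕ) : ℝ) = ((m + 1 : ℕ) : ℝ) + 1 := by push_cast; ring
      change Real.sin (m : ℝ) = Real.sin ((m + 2 : ℕ) : ℝ)
      rw [e1, e2, Real.sin_add, Real.sin_sub, hcos]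
      ring
    omega

theorem exists_natSin_gap {x : ℝ} (hx : x < 1) (K : ℕ) :
    ∃ v, x < v ∧ v ≤ 1 ∧ ∀ k : ℕ, k ≤ K → x < Real.sin k → v ≤ Real.sin k := by
  classical
  obtain ⟨v, hv⟩ := ((((Finset.range (K + 1)).image fun k : ℕ => Real.sin k).filter (x < ·)) ∪
    {1}).exists_minimal ⟨1, by simp⟩
  have hle : ∀ w ∈ ((((Finset.range (K + 1)).image fun k : ℕ => Real.sin k).filter (x < ·)) ∪
      {1} : Finset ℝ), v ≤ w := fun w hw => (le_total v w).elim id fun h => hv.2 hw h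
  refine ⟨v, ?_, hle 1 (by simp), fun k hk hxk => hle _ ?_⟩
  · have := hv.1
    simp only [Finset.mem_union, Finset.mem_filter, Finset.mem_singleton] at this
    rcases this with h | h
    · exact h.2
    · rwa [h]
  · simp only [Finset.mem_union, Finset.mem_filter, Finset.mem_image, Finset.mem_range]
    exact Or.inl ⟨⟨k, by omega, rfl⟩, hxk⟩

/-- Any natural number has the same best approximates as some larger one, but for the latter. -/
theorem exists_isBestApprox_extend (n M : ℕ) :
    ∃ m, M < m ∧ n < m ∧ ∀ Y, IsBestApprox m Y ↔ IsBestApprox n Y ∨ Y = m := by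
  classical
  -- The least `m` with sine in `(sin n, v)` works: no smaller number has sine there, so `m` and `n`
  -- have the same competitors below `m`. The choice of `v` forces `m > max n M`.
  obtain ⟨v, hnv, hv1, hgap⟩ := exists_natSin_gap (natSin_lt_one n) (max n M)
  have hex : ∃ k : ℕ, Real.sin n < Real.sin k ∧ Real.sin k < v := by
    obtain ⟨k, -, hk⟩ := exists_natSin_mem_Ioo hnv (Real.neg_one_le_sin _) hv1 0
    exact ⟨k, hk⟩
  obtain ⟨hnm, hmv⟩ := Nat.find_spec hex
  have hmin : ∀ k < Nat.find hex, ¬ (Real.sin n < Real.sin k ∧ Real.sin k < v) :=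
    fun k hk => Nat.find_min hex hk
  generalize Nat.find hex = m at hnm hmv hmin
  have hm : max n M < m := by
    by_contra! h
    exact (hgap m h hnm).not_gt hmv
  have hnm' : n < m := (le_max_left _ _).trans_lt hm
  have hiff : ∀ k < m, (Real.sin k ≤ Real.sin m ↔ Real.sin k ≤ Real.sin n) := fun k hk =>
    ⟨fun h => not_lt.1 fun h' => hmin k hk ⟨h', h.trans_lt hmv⟩, fun h => h.trans hnm.le⟩
  refine ⟨m, (le_max_right _ _).trans_lt hm, hnm', fun Y => ?_⟩
  rcases lt_trichotomy Y m with h | rfl | h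
  · rw [or_iff_left h.ne, isBestApprox_iff, isBestApprox_iff, hiff Y h]
    exact and_congr_right fun _ => forall_congr' fun k => imp_congr_right fun hk => by
      rw [hiff k (hk.trans_lt h)]
  · simp [isBestApprox_self]
  · exact iff_of_false (fun h' => h.not_ge h'.le)
      (not_or.2 ⟨fun h' => (hnm'.trans h).not_ge h'.le, h.ne'⟩)

/-! ### Encoding a finite set of pairs -/

theorem Finset.exists_pos_le_abs_of_ne_zero {α : Type*} (T : Finset α) (f : α → ℝ) :
    ∃ η > 0, ∀ x ∈ T, f x ≠ 0 → η ≤ |f x| := by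
  classical
  induction T using Finset.induction_on with
  | empty => exact ⟨1, one_pos, by simp⟩
  | insert a T _ ih =>
    obtain ⟨η, hη, h⟩ := ih
    by_cases ha : f a = 0
    · refine ⟨η, hη, fun x hx hfx => ?_⟩
      rcases Finset.mem_insert.1 hx with rfl | hx
      · exact absurd ha hfx
      · exact h x hx hfx
    · refine ⟨min η |f a|, lt_min hη (abs_pos.2 ha), fun x hx hfx => ?_⟩
      rcases Finset.mem_insert.1 hx with rfl | hx
      · exact min_le_right _ _
      · exact (min_le_left _ _).trans (h x hx hfx)

/-- The relation **Best** can be made to hold at any prescribed `s`, by restricting `sin X` to a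
smaller interval. -/
theorem exists_interval_best {u v : ℝ} (huv : u < v) (hu : 0 ≤ u) (hv : v ≤ 1) :
    ∃ N : ℕ, ∀ d ≥ N, ∀ s ≤ d, ∃ E : ℕ, ∀ e ≥ E, ∃ u' v' : ℝ, u ≤ u' ∧ u' < v' ∧ v' ≤ v ∧
      ∀ X : ℕ, u' < Real.sin X → Real.sin X < v' →
        ∃ Y, IsBestApproxUpTo X d Y ∧ Best d e Y X s := by
  classical
  obtain ⟨N, -, hN⟩ := exists_natSin_mem_Ioo huv (by linarith) hv 0
  refine ⟨N, fun d hd s hs => ?_⟩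
  obtain ⟨a, ha, hmax⟩ := Finset.exists_max_image
    ((Finset.range (d + 1)).filter fun n : ℕ => Real.sin n < v) (fun n : ℕ => Real.sin n)
    ⟨N, by simp [hN.2]; omega⟩
  simp only [Finset.mem_filter, Finset.mem_range, and_imp] at ha hmax
  have hua : u < Real.sin a := hN.1.trans_le (hmax N (by omega) hN.2)
  obtain ⟨Y, hsY, hY1, hY2⟩ := exists_natSin_mem_Ioo
    (u := Real.sin s) (v := min 1 (Real.sin s + (v - Real.sin a)))
    (lt_min (natSin_lt_one s) (by linarith)) (Real.neg_one_le_sin _) (min_le_left _ _) s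
  have hYL : Real.sin Y - Real.sin s < v - Real.sin a := by
    have := hY2.trans_le (min_le_right _ _)
    linarith
  set δ := Real.sin Y - Real.sin s with hδ
  have hδ0 : 0 < δ := sub_pos.2 hY1
  refine ⟨Y, fun e he => ?_⟩
  obtain ⟨η, hη, hgap⟩ := ((Finset.range (d + 1)) ×ˢ (Finset.range (e + 1))).exists_pos_le_abs_of_ne_zero
    (fun z : ℕ × ℕ => δ - |Real.sin z.2 - Real.sin z.1|)
  -- The three bounds make the optimum beat all other pairs, keep `sin X` above `sin a`, and keep
  -- the new interval below `v`.
  have hr : 0 < min (η / 2) (min δ (v - Real.sin a - δ)) :=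
    lt_min (by linarith) (lt_min hδ0 (by linarith))
  set r := min (η / 2) (min δ (v - Real.sin a - δ)) with hrdef
  have hr1 : r ≤ η / 2 := min_le_left _ _
  have hr2 : r ≤ δ := (min_le_right _ _).trans (min_le_left _ _)
  have hr3 : r ≤ v - Real.sin a - δ := (min_le_right _ _).trans (min_le_right _ _)
  refine ⟨Real.sin a + δ - r, Real.sin a + δ + r, by linarith, by linarith, by linarith,
    fun X hX1 hX2 => ⟨a, isBestApproxUpTo_iff.2 ⟨by omega, by linarith,
      fun n hn hnX => hmax n (by omega) (by linarith)⟩, Y, hs, he, hsY, fun Z₁ Z₂ hZ₁ hZ₂ hne => ?_⟩⟩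
  have hne' : δ - |Real.sin Z₂ - Real.sin Z₁| ≠ 0 := by
    intro h
    refine hne (abs_natSin_sub_eq hsY ?_)
    rw [← hδ, abs_of_pos hδ0]
    linarith
  have hη' := hgap (Z₁, Z₂) (by simp; omega) hne'
  simp only at hη'
  have h1 : sinDiffDist a X s Y < r := by
    rw [sinDiffDist, ← hδ, abs_of_pos hδ0, abs_lt]
    constructor <;> linarith
  have h2 : abs (δ - |Real.sin Z₂ - Real.sin Z₁|) ≤ sinDiffDist a X s Y + sinDiffDist a X Z₁ Z₂ := by
    rw [sinDiffDist, sinDiffDist, ← hδ, abs_of_pos hδ0,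
      abs_sub_comm (Real.sin X - Real.sin a) δ]
    exact abs_sub_le _ _ _
  linarith

/-- A triple of consecutive best approximates of `d''` is old, ends at `d` or `d'`, or is `(d, d',
d'')`. One ending at `d` or `d'` would need a best approximate of `e'` in `[x₁, d)`, and there is
none, as `x₂ < x₁` and `d ≤ e`. The last triple forces `e₁ = e` and `e₂ = e'`, where `Best` has only
one solution. -/
theorem member_extend {x₁ x₂ d e d' e' d'' X s₀ t₀ : ℕ} (h21 : x₂ < x₁) (h1d : x₁ < d)
    (hde : d ≤ e) (hed : e < d') (hde' : d' ≤ e') (hed' : e' < d'')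
    (hB₁ : ∀ Y, IsBestApprox d'' Y ↔ ((IsBestApprox x₁ Y ∨ Y = d) ∨ Y = d') ∨ Y = d'')
    (hB₂ : ∀ Y, IsBestApprox e' Y ↔ (IsBestApprox x₂ Y ∨ Y = e) ∨ Y = e')
    (hs : ∃ Y, IsBestApproxUpTo X d Y ∧ Best d e Y X s₀)
    (ht : ∃ Y, IsBestApproxUpTo X d' Y ∧ Best d' e' Y X t₀) (s t : ℕ) :
    Member d'' e' e' X s t ↔ Member x₁ x₂ x₂ X s t ∨ (s = s₀ ∧ t = t₀) := by
  have hle₁ : ∀ {Y}, IsBestApprox x₁ Y → Y ≤ x₁ := IsBestApprox.le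
  have hle₂ : ∀ {Y}, IsBestApprox x₂ Y → Y ≤ x₂ := IsBestApprox.le
  have hx₁ := isBestApprox_self x₁
  constructor
  · rintro ⟨d₁, d₂, d₃, d₄, e₁, e₂, ⟨⟨h12, hd₁, hd₂, hc12⟩, h23, -, hd₃, hc23⟩, ⟨h14, h42, hd₄⟩,
      ⟨h1e, he2, h2e, he3, he₁, he₂⟩, ⟨Y₁, hY₁, hb₁⟩, Y₂, hY₂, hb₂⟩
    simp only [hB₁, hB₂] at hd₁ hd₂ hd₃ hc12 hc23 hd₄ he₁ he₂
    have key₁ := hc12 x₁ (by simp [hx₁])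
    have key₂ := hc23 x₁ (by simp [hx₁])
    have key₃ := hc12 d (by simp)
    have key₄ := hc23 d (by simp)
    have key₅ := hc12 d' (by simp)
    have key₆ := hc23 d' (by simp)
    by_cases hlast : d₃ ≤ x₁
    · left
      have l₁ : IsBestApprox x₁ d₁ := by
        rcases hd₁ with ((h | h) | h) | h
        · exact h
        all_goals omega
      have l₂ : IsBestApprox x₁ d₂ := by
        rcases hd₂ with ((h | h) | h) | h
        · exact h
        all_goals omega
      have l₃ : IsBestApprox x₁ d₃ := by
        rcases hd₃ with ((h | h) | h) | h
        · exact h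
        all_goals omega
      have l₄ : IsBestApprox x₂ d₄ := by
        rcases hd₄ with (h | h) | h
        · exact h
        all_goals omega
      have l₅ : IsBestApprox x₂ e₁ := by
        rcases he₁ with (h | h) | h
        · exact h
        all_goals omega
      have l₆ : IsBestApprox x₂ e₂ := by
        rcases he₂ with (h | h) | h
        · exact h
        all_goals omega
      exact ⟨d₁, d₂, d₃, d₄, e₁, e₂,
        ⟨⟨h12, l₁, l₂, fun c hc => hc12 c (by simp [hc])⟩,
          h23, l₂, l₃, fun c hc => hc23 c (by simp [hc])⟩, ⟨h14, h42, l₄⟩,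
        ⟨h1e, he2, h2e, he3, l₅, l₆⟩, ⟨Y₁, hY₁, hb₁⟩, Y₂, hY₂, hb₂⟩
    · right
      have ho₁ : d₁ ≤ x₁ ∨ d₁ = d ∨ d₁ = d' ∨ d₁ = d'' := by
        rcases hd₁ with ((h | h) | h) | h
        · exact Or.inl (hle₁ h)
        all_goals omega
      have ho₂ : d₂ ≤ x₁ ∨ d₂ = d ∨ d₂ = d' ∨ d₂ = d'' := by
        rcases hd₂ with ((h | h) | h) | h
        · exact Or.inl (hle₁ h)
        all_goals omega
      have ho₃ : d₃ ≤ x₁ ∨ d₃ = d ∨ d₃ = d' ∨ d₃ = d'' := by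
        rcases hd₃ with ((h | h) | h) | h
        · exact Or.inl (hle₁ h)
        all_goals omega
      have ho₄ : e₁ ≤ x₂ ∨ e₁ = e ∨ e₁ = e' := by
        rcases he₁ with (h | h) | h
        · exact Or.inl (hle₂ h)
        all_goals omega
      have ho₅ : e₂ ≤ x₂ ∨ e₂ = e ∨ e₂ = e' := by
        rcases he₂ with (h | h) | h
        · exact Or.inl (hle₂ h)
        all_goals omega
      have q₁ : d₁ = d := by omega
      have q₂ : d₂ = d' := by omega
      have q₃ : e₁ = e := by omega
      have q₄ : e₂ = e' := by omega
      subst q₁ q₂ q₃ q₄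
      obtain ⟨Z₁, hZ₁, hs⟩ := hs
      obtain ⟨Z₂, hZ₂, ht⟩ := ht
      obtain rfl := hY₁.unique hZ₁
      obtain rfl := hY₂.unique hZ₂
      exact ⟨hb₁.unique hs, hb₂.unique ht⟩
  · rintro (⟨d₁, d₂, d₃, d₄, e₁, e₂, ⟨⟨h12, hd₁, hd₂, hc12⟩, h23, -, hd₃, hc23⟩,
      ⟨h14, h42, hd₄⟩, ⟨h1e, he2, h2e, he3, he₁, he₂⟩, hb₁, hb₂⟩ | ⟨rfl, rfl⟩)
    · have k₂ := hle₁ hd₂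
      have k₃ := hle₁ hd₃
      refine ⟨d₁, d₂, d₃, d₄, e₁, e₂,
        ⟨⟨h12, by simp [hB₁, hd₁], by simp [hB₁, hd₂], fun c hc => ?_⟩,
          h23, by simp [hB₁, hd₂], by simp [hB₁, hd₃], fun c hc => ?_⟩,
        ⟨h14, h42, by simp [hB₂, hd₄]⟩,
        ⟨h1e, he2, h2e, he3, by simp [hB₂, he₁], by simp [hB₂, he₂]⟩, hb₁, hb₂⟩
      · rcases (hB₁ c).1 hc with ((h | h) | h) | h
        · exact hc12 c h
        all_goals omega
      · rcases (hB₁ c).1 hc with ((h | h) | h) | h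
        · exact hc23 c h
        all_goals omega
    · refine ⟨d, d', d'', e, e, e',
        ⟨⟨by omega, by simp [hB₁], by simp [hB₁], fun c hc => ?_⟩,
          by omega, by simp [hB₁], by simp [hB₁], fun c hc => ?_⟩,
        ⟨hde, hed, by simp [hB₂]⟩,
        ⟨hde, hed, hde', hed', by simp [hB₂], by simp [hB₂]⟩, hs, ht⟩
      all_goals
        rcases (hB₁ c).1 hc with ((h | h) | h) | h
        · have := hle₁ h
          omega
        all_goals omega

theorem exists_member_interval (S : Set (ℕ × ℕ)) (hS : S.Finite) :
    ∃ x₁ x₂ : ℕ, ∃ u v : ℝ, x₂ < x₁ ∧ 0 ≤ u ∧ u < v ∧ v ≤ 1 ∧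
      ∀ X : ℕ, u < Real.sin X → Real.sin X < v →
        ∀ s t : ℕ, (s, t) ∈ S ↔ Member x₁ x₂ x₂ X s t := by
  induction S, hS using Set.Finite.induction_on with
  | empty =>
    -- With `x₂ = 0` no best approximate `e₂ ≥ d₂ > 0` exists.
    refine ⟨1, 0, 0, 1, one_pos, le_rfl, one_pos, le_rfl, fun X _ _ s t => ?_⟩
    simp only [Set.mem_empty_iff_false, false_iff]
    rintro ⟨d₁, d₂, d₃, d₄, e₁, e₂, ⟨⟨h12, -⟩, -⟩, -, ⟨-, -, h2e, -, -, he₂⟩, -⟩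
    have := he₂.le
    omega
  | @insert p S _ _ ih =>
    obtain ⟨s₀, t₀⟩ := p
    obtain ⟨x₁, x₂, u₀, v₀, h21, hu₀, huv₀, hv₀, hmem⟩ := ih
    obtain ⟨N, hN⟩ := exists_interval_best huv₀ hu₀ hv₀
    obtain ⟨d, hNd, h1d, hBd⟩ := exists_isBestApprox_extend x₁ (N + s₀)
    obtain ⟨E, hE⟩ := hN d (by omega) s₀ (by omega)
    -- `e` must exceed a bound depending on `d`, and the interval depends on `e`; hence the
    -- alternating choice of scales and intervals.
    obtain ⟨e, hEe, h2e, hBe⟩ := exists_isBestApprox_extend x₂ (E + d)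
    obtain ⟨u₁, v₁, hu₁, huv₁, hv₁, hbest₁⟩ := hE e (by omega)
    obtain ⟨N', hN'⟩ := exists_interval_best huv₁ (hu₀.trans hu₁) (hv₁.trans hv₀)
    obtain ⟨d', hNd', hdd', hBd'⟩ := exists_isBestApprox_extend d (N' + t₀ + e)
    obtain ⟨E', hE'⟩ := hN' d' (by omega) t₀ (by omega)
    obtain ⟨e', hEe', hee', hBe'⟩ := exists_isBestApprox_extend e (E' + d')
    obtain ⟨u₂, v₂, hu₂, huv₂, hv₂, hbest₂⟩ := hE' e' (by omega)
    obtain ⟨d'', hed'', hdd'', hBd''⟩ := exists_isBestApprox_extend d' e'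
    refine ⟨d'', e', u₂, v₂, hed'', hu₀.trans (hu₁.trans hu₂), huv₂, hv₂.trans (hv₁.trans hv₀),
      fun X hX1 hX2 s t => ?_⟩
    rw [member_extend h21 h1d (e := e) (d' := d') (by omega) (by omega) (by omega) hed''
      (by simp [hBd'', hBd', hBd]) (by simp [hBe', hBe])
      (hbest₁ X (by linarith) (by linarith)) (hbest₂ X hX1 hX2),
      ← hmem X (by linarith) (by linarith)]
    simp [or_comm]

theorem exists_member_iff (S : Set (ℕ × ℕ)) (hS : S.Finite) :
    ∃ X₁ X₂ X₃ X₄ : ℕ, ∀ s t : ℕ, (s, t) ∈ S ↔ Member X₁ X₂ X₃ X₄ s t := by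
  obtain ⟨x₁, x₂, u, v, -, hu, huv, hv, h⟩ := exists_member_interval S hS
  obtain ⟨X, -, hX1, hX2⟩ := exists_natSin_mem_Ioo huv (by linarith) hv 0
  exact ⟨x₁, x₂, x₂, X, h X hX1 hX2⟩

/-! ### Closure properties of quantifier-free definability -/

/-- A set of real vectors, defined by a quantifier-free formula. -/
def QFDefinable {n : ℕ} (P : (Fin n → ℝ) → Prop) : Prop :=
  ∃ φ : sinLanguage.Formula (Fin n), φ.IsQF ∧ ∀ v, φ.Realize v ↔ P v

/-- A real function that is given by a term. -/
def TermDefinable {n : ℕ} (f : (Fin n → ℝ) → ℝ) : Prop :=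
  ∃ t : sinLanguage.Term (Fin n), ∀ v, t.realize v = f v

namespace TermDefinable

variable {n : ℕ} {f g : (Fin n → ℝ) → ℝ}

theorem var (i : Fin n) : TermDefinable (fun v => v i) :=
  ⟨FirstOrder.Language.Term.var i, fun _ => rfl⟩

theorem zero : TermDefinable (fun _ : Fin n → ℝ => 0) :=
  ⟨FirstOrder.Language.Term.func (L := sinLanguage) SinFunc.zero Fin.elim0, fun _ => rfl⟩

theorem sin (hf : TermDefinable f) : TermDefinable (fun v => Real.sin (f v)) := by
  obtain ⟨t, ht⟩ := hf
  exact ⟨FirstOrder.Language.Term.func (L := sinLanguage) SinFunc.sin ![t],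
    fun v => congrArg Real.sin (ht v)⟩

theorem neg (hf : TermDefinable f) : TermDefinable (fun v => -f v) := by
  obtain ⟨t, ht⟩ := hf
  refine ⟨FirstOrder.Language.Term.func (L := sinLanguage) (SinFunc.scale (-1)) ![t], fun v => ?_⟩
  change ((-1 : ℚ) : ℝ) * t.realize v = -f v
  rw [ht]
  simp

theorem add (hf : TermDefinable f) (hg : TermDefinable g) :
    TermDefinable (fun v => f v + g v) := by
  obtain ⟨t, ht⟩ := hf
  obtain ⟨u, hu⟩ := hg
  exact ⟨FirstOrder.Language.Term.func (L := sinLanguage) SinFunc.add ![t, u],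
    fun v => congrArg₂ (· + ·) (ht v) (hu v)⟩

theorem sub (hf : TermDefinable f) (hg : TermDefinable g) :
    TermDefinable (fun v => f v - g v) := by
  simpa only [sub_eq_add_neg] using hf.add hg.neg

end TermDefinable

namespace QFDefinable

variable {n : ℕ} {P Q : (Fin n → ℝ) → Prop} {f g h : (Fin n → ℝ) → ℝ}

theorem congr (hP : QFDefinable P) (hPQ : ∀ v, P v ↔ Q v) : QFDefinable Q := by
  obtain ⟨φ, hφ, h⟩ := hP
  exact ⟨φ, hφ, fun v => (h v).trans (hPQ v)⟩

theorem lt (hf : TermDefinable f) (hg : TermDefinable g) : QFDefinable (fun v => f v < g v) := by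
  obtain ⟨t, ht⟩ := hf
  obtain ⟨u, hu⟩ := hg
  refine ⟨FirstOrder.Language.Relations.formula (L := sinLanguage) SinRel.lt ![t, u],
    (FirstOrder.Language.BoundedFormula.IsAtomic.rel _ _).isQF, fun v => ?_⟩
  refine FirstOrder.Language.Formula.realize_rel.trans ?_
  change t.realize v < u.realize v ↔ f v < g v
  rw [ht, hu]

theorem not (hP : QFDefinable P) : QFDefinable (fun v => ¬ P v) := by
  obtain ⟨φ, hφ, h⟩ := hP
  exact ⟨FirstOrder.Language.Formula.not φ, hφ.not,
    fun v => by rw [FirstOrder.Language.Formula.realize_not, h]⟩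

theorem imp (hP : QFDefinable P) (hQ : QFDefinable Q) : QFDefinable (fun v => P v → Q v) := by
  obtain ⟨φ, hφ, h⟩ := hP
  obtain ⟨ψ, hψ, h'⟩ := hQ
  exact ⟨FirstOrder.Language.Formula.imp φ ψ, hφ.imp hψ,
    fun v => by rw [FirstOrder.Language.Formula.realize_imp, h, h']⟩

theorem and (hP : QFDefinable P) (hQ : QFDefinable Q) : QFDefinable (fun v => P v ∧ Q v) :=
  (hP.imp hQ.not).not.congr fun v => by tauto

theorem or (hP : QFDefinable P) (hQ : QFDefinable Q) : QFDefinable (fun v => P v ∨ Q v) :=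
  (hP.not.imp hQ).congr fun v => by tauto

theorem le (hf : TermDefinable f) (hg : TermDefinable g) : QFDefinable (fun v => f v ≤ g v) :=
  (lt hg hf).not.congr fun _ => not_lt

theorem eq (hf : TermDefinable f) (hg : TermDefinable g) : QFDefinable (fun v => f v = g v) :=
  ((le hf hg).and (le hg hf)).congr fun _ => le_antisymm_iff.symm

theorem forall_fin {m : ℕ} {R : Fin m → (Fin n → ℝ) → Prop} (hR : ∀ i, QFDefinable (R i)) :
    QFDefinable (fun v => ∀ i, R i v) := by
  induction m with
  | zero => exact (lt TermDefinable.zero TermDefinable.zero).not.congr fun v => by simp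
  | succ m ih =>
    exact ((hR 0).and (ih fun i => hR i.succ)).congr fun v =>
      (Fin.forall_fin_succ (P := fun i => R i v)).symm

theorem abs_lt_abs (hf : TermDefinable f) (hg : TermDefinable g) :
    QFDefinable (fun v => |f v| < |g v|) :=
  (((lt hf hg).or (lt hf hg.neg)).and ((lt hf.neg hg).or (lt hf.neg hg.neg))).congr fun v => by
    rw [← lt_abs, ← lt_abs, ← max_lt_iff]
    rfl

/-- The signature has no absolute value, so the inner ones are removed by cases on signs. -/
theorem abs_sub_abs_lt (hf : TermDefinable f) (hg : TermDefinable g) (hh : TermDefinable h) :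
    QFDefinable (fun v => abs (f v - |g v|) < abs (f v - |h v|)) := by
  have z := TermDefinable.zero (n := n)
  refine ((((le z hg).imp ((le z hh).imp (abs_lt_abs (hf.sub hg) (hf.sub hh)))).and
    ((le z hg).imp ((lt hh z).imp (abs_lt_abs (hf.sub hg) (hf.sub hh.neg))))).and
    (((lt hg z).imp ((le z hh).imp (abs_lt_abs (hf.sub hg.neg) (hf.sub hh)))).and
    ((lt hg z).imp ((lt hh z).imp (abs_lt_abs (hf.sub hg.neg) (hf.sub hh.neg)))))).congr
    fun v => ?_
  rcases le_or_gt 0 (g v) with h1 | h1 <;> rcases le_or_gt 0 (h v) with h2 | h2 <;>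
    simp [h1, h2, h1.not_gt, h2.not_gt, abs_of_nonneg, abs_of_neg]

end QFDefinable

/-! ### The formula for `Member` -/

/-- The body of the universal formula for `IsBestApproxUpTo X d Y`. -/
def UpToMatrix (X d Y z : ℝ) : Prop :=
  Y ≤ d ∧ Real.sin Y ≤ Real.sin X ∧
    (0 ≤ z → z ≤ d → Real.sin z ≤ Real.sin X → Real.sin z ≤ Real.sin Y)

/-- The body of the universal formula for `ConsecutiveBestApprox X a b`. -/
def ConsecutiveMatrix (X a b z : ℝ) : Prop :=
  a < b ∧ UpToMatrix X a a z ∧ UpToMatrix X b b z ∧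
    (0 ≤ z → z < b → Real.sin z ≤ Real.sin X → Real.sin z ≤ Real.sin a)

/-- The body of the universal formula for `Best d e A X s`, with the larger entry `Y` given. -/
def BestMatrix (d e A X s Y z w : ℝ) : Prop :=
  s ≤ d ∧ Y ≤ e ∧ s < Y ∧
    (0 ≤ z → 0 ≤ w → z ≤ d → w ≤ e → ¬ ((z = s ∧ w = Y) ∨ (z = Y ∧ w = s)) →
      abs (Real.sin X - Real.sin A - |Real.sin Y - Real.sin s|) <
        abs (Real.sin X - Real.sin A - |Real.sin w - Real.sin z|))

theorem forall_upToMatrix_iff (X d Y : ℕ) :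
    (∀ z : ℤ, UpToMatrix X d Y z) ↔ IsBestApproxUpTo X d Y := by
  rw [isBestApproxUpTo_iff]
  constructor
  · intro h
    refine ⟨by exact_mod_cast (h 0).1, (h 0).2.1, fun n hn hs => ?_⟩
    simpa using (h n).2.2 (by simp) (by simpa using hn) (by simpa using hs)
  · rintro ⟨h1, h2, h3⟩ z
    refine ⟨by exact_mod_cast h1, h2, fun hz hzd hs => ?_⟩
    lift z to ℕ using by exact_mod_cast hz
    simp only [Int.cast_natCast, Nat.cast_le] at hzd hs ⊢
    exact h3 z hzd hs

theorem isBestApprox_iff_upTo_self (X Y : ℕ) : IsBestApprox X Y ↔ IsBestApproxUpTo X Y Y := by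
  simp [isBestApprox_iff, isBestApproxUpTo_iff]

/-- This removes the quantifier nested in `IsBestApprox X c`: the best candidate below `b` is itself
a best approximate, so it cannot lie beyond `a`. -/
theorem consecutiveBestApprox_iff {X a b : ℕ} : ConsecutiveBestApprox X a b ↔
    a < b ∧ IsBestApprox X a ∧ IsBestApprox X b ∧
      ∀ n : ℕ, n < b → Real.sin n ≤ Real.sin X → Real.sin n ≤ Real.sin a := by
  classical
  refine and_congr_right fun hab => and_congr_right fun ha => and_congr_right fun _ => ?_
  have ha' := isBestApprox_iff.1 ha
  constructor
  · intro h n hn hs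
    obtain ⟨c, hc, hmax⟩ := Finset.exists_max_image
      ((Finset.range b).filter fun n : ℕ => Real.sin n ≤ Real.sin X) (fun n : ℕ => Real.sin n)
      ⟨n, by simp [hn, hs]⟩
    simp only [Finset.mem_filter, Finset.mem_range, and_imp] at hc hmax
    have hcX : IsBestApprox X c :=
      isBestApprox_iff.2 ⟨hc.2, fun k hk => hmax k (hk.trans_lt hc.1)⟩
    have hca : c ≤ a := by
      by_contra! hac
      exact h c hcX ⟨hac, hc.1⟩
    exact (hmax n hn hs).trans (ha'.2 c hca hc.2)
  · rintro h c hc ⟨hac, hcb⟩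
    rw [isBestApprox_iff] at hc
    exact hac.ne (natSin_injective (le_antisymm (hc.2 a hac.le ha'.1) (h c hcb hc.1)))

theorem forall_consecutiveMatrix_iff (X a b : ℕ) :
    (∀ z : ℤ, ConsecutiveMatrix X a b z) ↔ ConsecutiveBestApprox X a b := by
  simp only [consecutiveBestApprox_iff, ConsecutiveMatrix, forall_and, forall_const,
    forall_upToMatrix_iff, isBestApprox_iff_upTo_self, Nat.cast_lt]
  refine and_congr_right fun _ => and_congr_right fun _ => and_congr_right fun _ => ?_
  constructor
  · intro h n hn hs
    simpa using h n (by simp) (by simpa using hn) (by simpa using hs)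
  · intro h z hz hzb hs
    lift z to ℕ using by exact_mod_cast hz
    simp only [Int.cast_natCast, Nat.cast_lt] at hzb hs ⊢
    exact h z hzb hs

theorem forall_bestMatrix_iff (d e A X s Y : ℕ) :
    (∀ z w : ℤ, BestMatrix d e A X s Y z w) ↔ s ≤ d ∧ Y ≤ e ∧ s < Y ∧
      ∀ Z₁ Z₂ : ℕ, Z₁ ≤ d → Z₂ ≤ e → ({Z₁, Z₂} : Set ℕ) ≠ {s, Y} →
        sinDiffDist A X s Y < sinDiffDist A X Z₁ Z₂ := by
  simp only [BestMatrix, forall_and, forall_const, Nat.cast_le, Nat.cast_lt, Ne,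
    Set.pair_eq_pair_iff]
  refine and_congr_right fun _ => and_congr_right fun _ => and_congr_right fun _ => ?_
  constructor
  · intro h z w hz hw hne
    have := h z w (by simp) (by simp) (by simpa using hz) (by simpa using hw)
      (by simpa only [Int.cast_natCast, Nat.cast_inj] using hne)
    simpa only [Int.cast_natCast, sinDiffDist] using this
  · intro h z w hz0 hw0 hz hw hne
    lift z to ℕ using by exact_mod_cast hz0
    lift w to ℕ using by exact_mod_cast hw0
    simp only [Int.cast_natCast, Nat.cast_le, Nat.cast_inj] at hz hw hne ⊢
    exact h z w hz hw hne

section Definable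

variable {n : ℕ} {X d Y z w e A s a b : (Fin n → ℝ) → ℝ}

theorem qfDefinable_upToMatrix (hX : TermDefinable X) (hd : TermDefinable d)
    (hY : TermDefinable Y) (hz : TermDefinable z) :
    QFDefinable (fun v => UpToMatrix (X v) (d v) (Y v) (z v)) :=
  (QFDefinable.le hY hd).and <| (QFDefinable.le hY.sin hX.sin).and <|
    (QFDefinable.le .zero hz).imp <| (QFDefinable.le hz hd).imp <|
      (QFDefinable.le hz.sin hX.sin).imp (QFDefinable.le hz.sin hY.sin)

theorem qfDefinable_consecutiveMatrix (hX : TermDefinable X) (ha : TermDefinable a)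
    (hb : TermDefinable b) (hz : TermDefinable z) :
    QFDefinable (fun v => ConsecutiveMatrix (X v) (a v) (b v) (z v)) :=
  (QFDefinable.lt ha hb).and <| (qfDefinable_upToMatrix hX ha ha hz).and <|
    (qfDefinable_upToMatrix hX hb hb hz).and <|
    (QFDefinable.le .zero hz).imp <| (QFDefinable.lt hz hb).imp <|
      (QFDefinable.le hz.sin hX.sin).imp (QFDefinable.le hz.sin ha.sin)

theorem qfDefinable_bestMatrix (hd : TermDefinable d) (he : TermDefinable e)
    (hA : TermDefinable A) (hX : TermDefinable X) (hs : TermDefinable s) (hY : TermDefinable Y)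
    (hz : TermDefinable z) (hw : TermDefinable w) :
    QFDefinable (fun v => BestMatrix (d v) (e v) (A v) (X v) (s v) (Y v) (z v) (w v)) :=
  (QFDefinable.le hs hd).and <| (QFDefinable.le hY he).and <| (QFDefinable.lt hs hY).and <|
    (QFDefinable.le .zero hz).imp <| (QFDefinable.le .zero hw).imp <|
    (QFDefinable.le hz hd).imp <| (QFDefinable.le hw he).imp <|
    (((QFDefinable.eq hz hs).and (QFDefinable.eq hw hY)).or
      ((QFDefinable.eq hz hY).and (QFDefinable.eq hw hs))).not.imp <|
    QFDefinable.abs_sub_abs_lt (hX.sin.sub hA.sin) (hY.sin.sub hs.sin) (hw.sin.sub hz.sin)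

end Definable

/-- The matrix of the formula for **Member**.  The existential variables `y` stand for
`d₁, d₂, d₃, d₄, e₁, e₂`, then `X₄|_{d₁}`, `X₄|_{d₂}`, then the larger entries of the two pairs. -/
def MemberMatrix (x : Fin 6 → ℝ) (y : Fin 10 → ℝ) (z : Fin 14 → ℝ) : Prop :=
  ((∀ i, 0 ≤ x i) ∧ (∀ i, 0 ≤ y i)) ∧
  (ConsecutiveMatrix (x 0) (y 0) (y 1) (z 0) ∧ ConsecutiveMatrix (x 0) (y 1) (y 2) (z 0)) ∧
  (y 0 ≤ y 3 ∧ y 3 < y 1 ∧ UpToMatrix (x 2) (y 3) (y 3) (z 0)) ∧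
  (y 0 ≤ y 4 ∧ y 4 < y 1 ∧ y 1 ≤ y 5 ∧ y 5 < y 2 ∧
    UpToMatrix (x 1) (y 4) (y 4) (z 0) ∧ UpToMatrix (x 1) (y 5) (y 5) (z 0)) ∧
  (UpToMatrix (x 3) (y 0) (y 6) (z 0) ∧
    BestMatrix (y 0) (y 4) (y 6) (x 3) (x 4) (y 8) (z 0) (z 1)) ∧
  (UpToMatrix (x 3) (y 1) (y 7) (z 0) ∧
    BestMatrix (y 1) (y 5) (y 7) (x 3) (x 5) (y 9) (z 0) (z 1))

theorem qfDefinable_memberMatrix : QFDefinable (fun v : Fin (6 + 10 + 14) → ℝ =>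
    MemberMatrix (fun i => v (Fin.castAdd 14 (Fin.castAdd 10 i)))
      (fun i => v (Fin.castAdd 14 (Fin.natAdd 6 i))) (fun i => v (Fin.natAdd (6 + 10) i))) := by
  refine .and (.and (.forall_fin fun i => .le .zero (.var _)) (.forall_fin fun i => .le .zero (.var _))) <|
    .and (.and ?_ ?_) <| .and (.and (.le (.var _) (.var _)) <| .and (.lt (.var _) (.var _)) ?_) <|
    .and (.and (.le (.var _) (.var _)) <| .and (.lt (.var _) (.var _)) <|
      .and (.le (.var _) (.var _)) <| .and (.lt (.var _) (.var _)) <| .and ?_ ?_) <|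
    .and (.and ?_ ?_) (.and ?_ ?_)
  all_goals first
    | exact qfDefinable_consecutiveMatrix (.var _) (.var _) (.var _) (.var _)
    | exact qfDefinable_upToMatrix (.var _) (.var _) (.var _) (.var _)
    | exact qfDefinable_bestMatrix (.var _) (.var _) (.var _) (.var _) (.var _) (.var _) (.var _)
        (.var _)

/-- All clauses reuse `z 0` and `z 1`; the other universal variables are dummies. -/
theorem forall_memberMatrix_iff (x : Fin 6 → ℕ) (y : Fin 10 → ℕ) :
    (∀ z : Fin 14 → ℤ, MemberMatrix (fun i => x i) (fun i => y i) (fun i => z i)) ↔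
      (ConsecutiveBestApprox (x 0) (y 0) (y 1) ∧ ConsecutiveBestApprox (x 0) (y 1) (y 2)) ∧
      (y 0 ≤ y 3 ∧ y 3 < y 1 ∧ IsBestApprox (x 2) (y 3)) ∧
      (y 0 ≤ y 4 ∧ y 4 < y 1 ∧ y 1 ≤ y 5 ∧ y 5 < y 2 ∧
        IsBestApprox (x 1) (y 4) ∧ IsBestApprox (x 1) (y 5)) ∧
      (IsBestApproxUpTo (x 3) (y 0) (y 6) ∧
        ∀ z w : ℤ, BestMatrix (y 0) (y 4) (y 6) (x 3) (x 4) (y 8) z w) ∧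
      (IsBestApproxUpTo (x 3) (y 1) (y 7) ∧
        ∀ z w : ℤ, BestMatrix (y 1) (y 5) (y 7) (x 3) (x 5) (y 9) z w) := by
  have h₁ (P : ℤ → Prop) : (∀ z : Fin 14 → ℤ, P (z 0)) ↔ ∀ z, P z :=
    ⟨fun h z => h fun _ => z, fun h z => h _⟩
  have h₂ (P : ℤ → ℤ → Prop) : (∀ z : Fin 14 → ℤ, P (z 0) (z 1)) ↔ ∀ z w, P z w :=
    ⟨fun h z w => h (Fin.cons z fun _ => w), fun h z => h _ _⟩
  simp only [← forall_consecutiveMatrix_iff, isBestApprox_iff_upTo_self, ← forall_upToMatrix_iff]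
  simp only [← h₂]
  simp only [← h₁, MemberMatrix, Nat.cast_nonneg, Nat.cast_le, Nat.cast_lt, implies_true,
    true_and, forall_and, forall_const]

theorem existsForallDefinable_member : ExistsForallDefinable 10 14
    {v : Fin 6 → ℤ | ∃ w : Fin 6 → ℕ, (∀ i, v i = (w i : ℤ)) ∧
      Member (w 0) (w 1) (w 2) (w 3) (w 4) (w 5)} := by
  obtain ⟨φ, hφ, hreal⟩ := qfDefinable_memberMatrix
  refine ⟨.ex 10 (.all 14 (.matrix φ hφ)), ⟨φ, hφ, rfl⟩, ?_⟩
  ext v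
  have hholds : (SinPAFormula.ex 10 (.all 14 (.matrix φ hφ))).Holds v ↔
      ∃ y : Fin 10 → ℤ, ∀ z : Fin 14 → ℤ,
        MemberMatrix (fun i => v i) (fun i => y i) (fun i => z i) := by
    simp only [SinPAFormula.Holds, hreal, Fin.append_left, Fin.append_right]
  rw [Set.mem_ofPred_eq, Set.mem_ofPred_eq, hholds]
  constructor
  · rintro ⟨w, hw, d₁, d₂, d₃, d₄, e₁, e₂, h1, h2, h3, ⟨A, hA, Y, hY⟩, B, hB, Z, hZ⟩
    obtain rfl : v = fun i => (w i : ℤ) := funext hw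
    refine ⟨fun i => ((![d₁, d₂, d₃, d₄, e₁, e₂, A, B, Y, Z] : Fin 10 → ℕ) i : ℤ), ?_⟩
    simp only [Int.cast_natCast]
    rw [forall_memberMatrix_iff]
    exact ⟨h1, h2, h3, ⟨hA, (forall_bestMatrix_iff ..).2 hY⟩, hB, (forall_bestMatrix_iff ..).2 hZ⟩
  · rintro ⟨y, hy⟩
    -- The sign conditions do not involve `z`, so any instance yields them.
    obtain ⟨⟨hv0, hy0⟩, -⟩ := hy 0
    lift v to Fin 6 → ℕ using fun i => by exact Int.cast_nonneg_iff.1 (hv0 i)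
    lift y to Fin 10 → ℕ using fun i => by exact Int.cast_nonneg_iff.1 (hy0 i)
    simp only [Int.cast_natCast] at hy
    rw [forall_memberMatrix_iff] at hy
    obtain ⟨h1, h2, h3, ⟨hA, hY⟩, hB, hZ⟩ := hy
    exact ⟨v, fun _ => rfl, y 0, y 1, y 2, y 3, y 4, y 5, h1, h2, h3,
      ⟨y 6, hA, y 8, (forall_bestMatrix_iff ..).1 hY⟩, y 7, hB, y 9, (forall_bestMatrix_iff ..).1 hZ⟩

theorem mainTheorem4 :
    (∀ S : Set (ℕ × ℕ), S.Finite →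
      ∃ X₁ X₂ X₃ X₄ : ℕ, ∀ s t : ℕ, (s, t) ∈ S ↔ Member X₁ X₂ X₃ X₄ s t) ∧
    ExistsForallDefinable 10 14
      {v : Fin 6 → ℤ | ∃ w : Fin 6 → ℕ, (∀ i, v i = (w i : ℤ)) ∧
        Member (w 0) (w 1) (w 2) (w 3) (w 4) (w 5)} :=
  ⟨exists_member_iff, existsForallDefinable_member⟩
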